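/- Consider the following online problem on the segment $[-1,1]$ (the Orienteering Problem with Time Windows and Delay). A request is a triple consisting of a location $A\in[-1,1]$, a release time $r\ge 0$ and a weight $\delta>0$; its time window is $[r,r+2]$. For $n\ge 1$ and $T\ge 0$ let $\mathcal I_{n,T}$ be the set of all non-empty finite sets $I$ of at most $n$ requests such that the release times of any two distinct requests of $I$ differ by at least $T$. An itinerary is a map $x:[0,\infty)\to[-1,1]$ with $x(0)=0$ and $|x(s)-x(t)|\le|s-t|$ for all $s,t\ge 0$; it serves the request $(A,r,\delta)$ if $x(t)=A$ for some $t\in[r,r+2]$. A (deterministic) online algorithm $ALG$ assigns to every finite set $I$ of requests an itinerary $x_I$ in such a way that, whenever two sets $I$ and $J$ contain the same requests with release time at most $t$, the itineraries $x_I$ and $x_J$ coincide on $[0,t]$. The performance $\lambda^I_{ALG}$ of $ALG$ on a non-empty $I$ is the total weight of the requests of $I$ served by $x_I$ divided by the total weight of all requests of $I$, and the optimal performance for at most $n$ requests and delay $T$ is $$\lambda^{\mathcal I_{n,T}}=\sup_{ALG}\ \inf_{I\in\mathcal I_{n,T}}\lambda^I_{ALG}.$$ **Corollary.** For every real $T$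 with $\frac12\le T<1$, $$\lambda^{\mathcal I_{3,T}}=\frac1{\varphi^2}\qquad\text{and}\qquad\lambda^{\mathcal I_{4,T}}=1-\frac{\sqrt2}2,$$ where $\varphi=\frac{1+\sqrt5}2$ is the golden ratio. -/

import Mathlib

namespace OPTiWinD

/-- A request on the segment `[-1, 1]`: its location, its release time (the vehicle starts at
time `0`) and its positive weight. Its time window is `[release, release + 2]`. -/
structure Request where
  loc : ℝ
  release : ℝ
  weight : ℝ
  loc_mem : loc ∈ Set.Icc (-1 : ℝ) 1
  release_nonneg : 0 ≤ release
  weight_pos : 0 < weight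

/-- An itinerary of the vehicle in `[-1, 1]`: it starts at the origin at time `0` and moves at
speed at most `1`. Only the values of `pos` at times `t ≥ 0` are meaningful. -/
structure Itinerary where
  pos : ℝ → ℝ
  start : pos 0 = 0
  mem : ∀ t, 0 ≤ t → pos t ∈ Set.Icc (-1 : ℝ) 1
  speed : ∀ s t, 0 ≤ s → 0 ≤ t → |pos s - pos t| ≤ |s - t|

/-- The request `q` is served if the vehicle is at its location at some time of its window. -/
def Itinerary.Serves (x : Itinerary) (q : Request) : Prop :=
  ∃ t ∈ Set.Icc q.release (q.release + 2), x.pos t = q.loc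

/-- An instance is a finite set of requests. -/
abbrev Instance := Finset Request

open Classical in
/-- The part of an instance that has been released up to and including time `t`. -/
noncomputable def revealed (I : Instance) (t : ℝ) : Instance :=
  I.filter (fun q => q.release ≤ t)

/-- The class of instances with at most `n` requests (and at least one, since the performance is
a ratio by the total weight) and with delay at least `T` between any two requests. -/
def instances (n : ℕ) (T : ℝ) : Set Instance :=
  {I | I.Nonempty ∧ I.card ≤ n ∧
    ∀ p ∈ I, ∀ q ∈ I, p ≠ q → T ≤ |p.release - q.release|}

/-- A (deterministic) online algorithm: it assigns an itinerary to every instance, and the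
movement up to time `t` only depends on the requests released up to time `t`. -/
structure OnlineAlgorithm where
  route : Instance → Itinerary
  online : ∀ (I J : Instance) (t : ℝ), revealed I t = revealed J t →
    ∀ s, 0 ≤ s → s ≤ t → (route I).pos s = (route J).pos s

open Classical in
/-- The performance of an algorithm on an instance: the total weight of the served requests
divided by the total weight of all requests. -/
noncomputable def OnlineAlgorithm.performanceOn (A : OnlineAlgorithm) (I : Instance) : ℝ :=
  (∑ q ∈ I with (A.route I).Serves q, q.weight) / ∑ q ∈ I, q.weight

/-- The performance of an algorithm for at most `n` requests and delay `T`: the infimum of its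
performances over all such instances. -/
noncomputable def OnlineAlgorithm.performance (A : OnlineAlgorithm) (n : ℕ) (T : ℝ) : ℝ :=
  ⨅ I : instances n T, A.performanceOn I

/-- The optimal performance for at most `n` requests and delay `T`: the supremum of the
performances of all online algorithms. -/
noncomputable def optimalPerformance (n : ℕ) (T : ℝ) : ℝ :=
  ⨆ A : OnlineAlgorithm, A.performance n T

end OPTiWinD

namespace OPTiWinD

/-! ### Itineraries -/

/-! Both values equal `1 / (1 + w)`, where `w > 0` and `w * (1 + w) = 1 + (n - 1) * w`: `w` is the
golden ratio for `n = 3` and `1 + √2` for `n = 4`.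

Upper bound: the adversary uses only the ends `±1` and the weights `1, w, w, ...`. When the vehicle
is about to serve one end, a request appears at the other. Segment and windows both have length 2,
so at most one of the two can be served (`Itinerary.not_serves_both`). Refusing the second request
leaves weight `1` out of `1 + w`. Otherwise the game goes on until `n` requests are out, at most one
of which is served: weight at most `w` out of `1 + (n - 1) * w = w * (1 + w)`. For `n = 4` the third
request comes when the vehicle crosses the origin. From there no end is reached within `T < 1`, so a
fourth request can be held against whichever end it chooses.

Lower bound: `greedy w` drops its first destination only for a weight exceeding `w` times that of
the first request, and any later destination for every larger weight. The first location is within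
distance 1 of the origin and two delays last at least 1, so the first request, unless dropped, is
reached before the third appears. This yields the invariant `GreedyState.Favourable`, and
`GreedyState.Favourable.total_le` turns it into the bound. -/

lemma Itinerary.continuousOn (x : Itinerary) : ContinuousOn x.pos (Set.Ici 0) := by
  have : LipschitzOnWith 1 x.pos (Set.Ici 0) := by
    refine LipschitzOnWith.of_dist_le_mul fun s hs t ht => ?_
    simpa [Real.dist_eq] using x.speed s t hs ht
  exact this.continuousOn

lemma Itinerary.abs_pos_le (x : Itinerary) {t : ℝ} (ht : 0 ≤ t) : |x.pos t| ≤ t := by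
  simpa [x.start, abs_of_nonneg ht] using x.speed t 0 ht le_rfl

/-- A vehicle that visits `B` within `[lo, hi]`, but not before time `m`, can be observed
arbitrarily close to `B` after time `m` and before its first visit. -/
lemma Itinerary.exists_before_hit (x : Itinerary) {lo hi m B ε : ℝ} (hlo : 0 ≤ lo) (hm : lo ≤ m)
    (hε : 0 < ε) (hit : ∃ s ∈ Set.Icc lo hi, x.pos s = B)
    (hno : ∀ s ∈ Set.Icc lo m, x.pos s ≠ B) :
    ∃ t, m ≤ t ∧ t < hi ∧ |x.pos t - B| < ε ∧ ∀ s ∈ Set.Icc lo t, x.pos s ≠ B := by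
  have hcont : ContinuousOn x.pos (Set.Icc lo hi) :=
    x.continuousOn.mono fun s hs => hlo.trans hs.1
  have hcomp : IsCompact (Set.Icc lo hi ∩ x.pos ⁻¹' {B}) :=
    isCompact_Icc.of_isClosed_subset
      (hcont.preimage_isClosed_of_isClosed isClosed_Icc isClosed_singleton) Set.inter_subset_left
  obtain ⟨s, hs, hsB⟩ := hit
  obtain ⟨s₀, ⟨hs₀, hs₀B⟩, hleast⟩ := hcomp.exists_isLeast ⟨s, hs, hsB⟩
  have hms : m < s₀ := by
    by_contra h
    exact hno s₀ ⟨hs₀.1, not_lt.1 h⟩ hs₀B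
  -- Shortly before the first visit `s₀`, unit speed keeps the vehicle within `ε` of `B`; the
  -- maximum with `m` enforces the delay.
  have hmax : max m (s₀ - ε / 2) < s₀ := max_lt hms (by linarith)
  refine ⟨max m (s₀ - ε / 2), le_max_left _ _, hmax.trans_le hs₀.2, ?_, ?_⟩
  · have h0 : 0 ≤ max m (s₀ - ε / 2) := (hlo.trans hm).trans (le_max_left _ _)
    have h := x.speed _ s₀ h0 (hlo.trans hs₀.1)
    rw [show x.pos s₀ = B from hs₀B, abs_sub_comm _ s₀, abs_of_pos (sub_pos.2 hmax)] at h
    linarith [le_max_right m (s₀ - ε / 2)]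
  · intro u hu huB
    have : s₀ ≤ u := hleast ⟨⟨hu.1, (hu.2.trans_lt hmax).le.trans hs₀.2⟩, huB⟩
    linarith [hu.2]

/-- Two requests at opposite ends cannot both be served if the first one is still open when the
second one is released. -/
lemma Itinerary.not_serves_both (x : Itinerary) {p q : Request} (hd : |p.loc - q.loc| = 2)
    (hpq : p.release < q.release)
    (hno : ∀ s ∈ Set.Icc p.release q.release, x.pos s ≠ p.loc) :
    ¬ (x.Serves p ∧ x.Serves q) := by
  rintro ⟨⟨s, hs, hsp⟩, ⟨t, ht, htq⟩⟩
  have hsq : q.release < s := by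
    by_contra h
    exact hno s ⟨hs.1, not_lt.1 h⟩ hsp
  have h := x.speed s t (p.release_nonneg.trans hs.1) (q.release_nonneg.trans ht.1)
  rw [hsp, htq, hd] at h
  -- Serving `p` first brings the vehicle to `q` after `q.release + 2`; serving `q` first brings it
  -- to `p` after `p.release + 2`.
  rcases le_abs.1 h with h | h <;> linarith [hs.2, ht.2, ht.1]

/-- Used to show that lost requests stay lost: the past agrees with `u`, and from time `t` on the
remaining window is too short for the distance. -/
lemma Itinerary.not_serves_of_far (x u : Itinerary) {p : Request} {t : ℝ} (ht : 0 ≤ t)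
    (heq : ∀ s, 0 ≤ s → s ≤ t → x.pos s = u.pos s) (hu : ¬ u.Serves p)
    (hfar : p.release + 2 - t < |u.pos t - p.loc|) : ¬ x.Serves p := by
  rintro ⟨s, hs, hsp⟩
  have hs0 : 0 ≤ s := p.release_nonneg.trans hs.1
  by_cases hst : s ≤ t
  · exact hu ⟨s, hs, by rw [← heq s hs0 hst, hsp]⟩
  · have h := x.speed t s ht hs0
    rw [heq t ht le_rfl, hsp, abs_sub_comm t s, abs_of_pos (by linarith : 0 < s - t)] at h
    linarith [hs.2]

/-! ### Online algorithms -/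

open Classical in
lemma revealed_insert_of_lt (I : Instance) {q : Request} {t : ℝ} (h : t < q.release) :
    revealed (insert q I) t = revealed I t := by
  simp [revealed, Finset.filter_insert, not_le.2 h]

open Classical in
-- The online condition gives agreement only strictly before `q.release`; the release time itself
-- follows from the speed bound. Hence the adversary may choose `q.release` by watching the route
-- planned without `q`.
lemma OnlineAlgorithm.route_insert_eq (A : OnlineAlgorithm) (I : Instance) (q : Request) {s : ℝ}
    (hs : 0 ≤ s) (hsq : s ≤ q.release) :
    (A.route (insert q I)).pos s = (A.route I).pos s := by
  have key : ∀ u, 0 ≤ u → u < q.release →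
      (A.route (insert q I)).pos u = (A.route I).pos u := fun u h0 hu =>
    A.online _ _ u (revealed_insert_of_lt I hu) u h0 le_rfl
  rcases hsq.lt_or_eq with h | rfl
  · exact key s hs h
  rcases q.release_nonneg.eq_or_lt with h0 | h0
  · rw [← h0, Itinerary.start, Itinerary.start]
  refine eq_of_forall_dist_le fun ε hε => ?_
  rw [Real.dist_eq]
  set u := max 0 (q.release - ε / 2) with hu
  have hu0 : 0 ≤ u := le_max_left _ _
  have huq : u < q.release := max_lt h0 (by linarith)
  have h1 := (A.route (insert q I)).speed q.release u hs hu0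
  have h2 := (A.route I).speed q.release u hs hu0
  rw [key u hu0 huq, abs_of_pos (sub_pos.2 huq)] at h1
  rw [abs_of_pos (sub_pos.2 huq)] at h2
  have : q.release - ε / 2 ≤ u := le_max_right _ _
  rw [abs_le] at *
  constructor <;> linarith [h1.1, h1.2, h2.1, h2.2]

lemma OnlineAlgorithm.performanceOn_nonneg (A : OnlineAlgorithm) (I : Instance) :
    0 ≤ A.performanceOn I :=
  div_nonneg (Finset.sum_nonneg fun q _ => q.weight_pos.le)
    (Finset.sum_nonneg fun q _ => q.weight_pos.le)

lemma OnlineAlgorithm.performance_le (A : OnlineAlgorithm) {n : ℕ} {T : ℝ} {I : Instance}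
    (hI : I ∈ instances n T) : A.performance n T ≤ A.performanceOn I :=
  ciInf_le (f := fun I : instances n T => A.performanceOn I)
    ⟨0, by rintro _ ⟨J, rfl⟩; exact A.performanceOn_nonneg J⟩ ⟨I, hI⟩

/-- The performance of an algorithm is small if it serves at most one request of an instance. -/
lemma OnlineAlgorithm.performance_le_of_single (A : OnlineAlgorithm) {n : ℕ} {T m : ℝ}
    {I : Instance} (hI : I ∈ instances n T) (hm : 0 ≤ m)
    (hone : ∀ p ∈ I, ∀ q ∈ I, (A.route I).Serves p → (A.route I).Serves q → p = q)
    (hle : ∀ p ∈ I, (A.route I).Serves p → p.weight ≤ m) :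
    A.performance n T ≤ m / ∑ q ∈ I, q.weight := by
  classical
  refine (A.performance_le hI).trans ?_
  unfold performanceOn
  gcongr
  · exact Finset.sum_nonneg fun q _ => q.weight_pos.le
  have hcard : (I.filter fun q => (A.route I).Serves q).card ≤ 1 := by
    rw [Finset.card_le_one]
    intro p hp q hq
    rw [Finset.mem_filter] at hp hq
    exact hone p hp.1 q hq.1 hp.2 hq.2
  calc _ ≤ (I.filter fun q => (A.route I).Serves q).card • m := by
        convert Finset.sum_le_card_nsmul _ (fun q : Request => q.weight) m ?_ using 2
        intro p hp
        rw [Finset.mem_filter] at hp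
        exact hle p hp.1 hp.2
    _ ≤ 1 • m := nsmul_le_nsmul_left hm hcard
    _ = m := one_nsmul m

open Classical in
lemma insert_mem_instances {n : ℕ} {T : ℝ} {I : Instance} {q : Request}
    (hI : I ∈ instances n T) (hq : ∀ p ∈ I, p.release + T ≤ q.release) :
    insert q I ∈ instances (n + 1) T := by
  refine ⟨Finset.insert_nonempty _ _,
    (Finset.card_insert_le _ _).trans (Nat.succ_le_succ hI.2.1), ?_⟩
  intro a ha b hb hab
  rw [Finset.mem_insert] at ha hb
  rcases ha with rfl | ha <;> rcases hb with rfl | hb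
  · exact absurd rfl hab
  · exact le_abs.2 (Or.inl (by linarith [hq b hb]))
  · exact le_abs.2 (Or.inr (by linarith [hq a ha]))
  · exact hI.2.2 a ha b hb hab

lemma instances_mono {m n : ℕ} {S T : ℝ} (hmn : m ≤ n) (hST : S ≤ T) :
    instances m T ⊆ instances n S := fun _ hI =>
  ⟨hI.1, hI.2.1.trans hmn, fun p hp q hq hpq => hST.trans (hI.2.2 p hp q hq hpq)⟩

/-! ### The adversary -/

open Classical in
/-- If the vehicle is on its way to serve an end point `p.loc`, then a request at the other end
can be released just before it arrives, in conflict with `p`. -/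
lemma OnlineAlgorithm.exists_conflict (A : OnlineAlgorithm) (I : Instance) {p : Request}
    {m ε w : ℝ} (hw : 0 < w) (hε : 0 < ε) (hB : |p.loc| = 1) (hpm : p.release < m)
    (hserve : (A.route I).Serves p)
    (hno : ∀ s ∈ Set.Icc p.release m, (A.route I).pos s ≠ p.loc) :
    ∃ q : Request, q.loc = -p.loc ∧ q.weight = w ∧ m ≤ q.release ∧
      |(A.route I).pos q.release - p.loc| < ε ∧
      ¬ ((A.route (insert q I)).Serves p ∧ (A.route (insert q I)).Serves q) := by
  obtain ⟨t, hmt, -, hclose, hnot⟩ := (A.route I).exists_before_hit p.release_nonneg hpm.le hε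
    hserve hno
  have ht : p.release < t := hpm.trans_le hmt
  let q : Request := ⟨-p.loc, t, w, by
    rw [Set.mem_Icc, ← abs_le, abs_neg, hB], p.release_nonneg.trans ht.le, hw⟩
  refine ⟨q, rfl, rfl, hmt, hclose, ?_⟩
  refine Itinerary.not_serves_both _ ?_ ht fun s hs => ?_
  · change |p.loc - -p.loc| = 2
    rw [sub_neg_eq_add, ← two_mul, abs_mul, hB]
    norm_num
  · rw [A.route_insert_eq I q (p.release_nonneg.trans hs.1) hs.2]
    exact hnot s hs

open Classical in
/-- The opening of the adversary: a request at `1` and, just before it is served, a request at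
`-1`. The algorithm must give up the first one. -/
lemma OnlineAlgorithm.exists_opening (A : OnlineAlgorithm) {n : ℕ} {T w ε : ℝ} (hn : 2 ≤ n)
    (hT : 1 / 2 ≤ T) (hw : 0 < w) (hε : 0 < ε) (hε' : ε + T < 1) :
    A.performance n T ≤ 1 / (1 + w) ∨
    ∃ q₁ q₂ : Request, q₁.loc = 1 ∧ q₁.release = 0 ∧ q₁.weight = 1 ∧
      q₂.loc = -1 ∧ q₂.weight = w ∧ T ≤ q₂.release ∧ 1 - ε < q₂.release ∧
      1 - ε < (A.route {q₂, q₁}).pos q₂.release ∧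
      {q₂, q₁} ∈ instances 2 T ∧
      (A.route {q₂, q₁}).Serves q₂ ∧ ¬ (A.route {q₂, q₁}).Serves q₁ := by
  let q₁ : Request := ⟨1, 0, 1, by norm_num, le_rfl, one_pos⟩
  have h1 : ({q₁} : Instance) ∈ instances 1 T :=
    ⟨Finset.singleton_nonempty _, by simp, by
      intro p hp q hq hpq
      rw [Finset.mem_singleton] at hp hq
      exact absurd (hp.trans hq.symm) hpq⟩
  by_cases hs1 : (A.route {q₁}).Serves q₁
  swap
  · left
    refine (A.performance_le_of_single (m := 0) (instances_mono (by omega) le_rfl h1) le_rfl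
      ?_ ?_).trans ?_
    · intro p hp q hq _ _
      rw [Finset.mem_singleton] at hp hq
      exact hp.trans hq.symm
    · intro p hp hp'
      rw [Finset.mem_singleton] at hp
      exact absurd (hp ▸ hp') hs1
    · rw [zero_div]
      positivity
  obtain ⟨q₂, hloc, hwt, hrel, hclose, hconf⟩ := A.exists_conflict {q₁} (m := T) hw hε
    (by simp [q₁]) (by change (0 : ℝ) < T; linarith) hs1 (by
      intro s hs h
      have := (A.route {q₁}).abs_pos_le hs.1
      rw [h] at this
      have h3 : s ≤ T := hs.2
      change |(1 : ℝ)| ≤ s at this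
      rw [abs_one] at this
      linarith)
  change q₂.loc = -1 at hloc
  change |(A.route {q₁}).pos q₂.release - 1| < ε at hclose
  rw [← A.route_insert_eq {q₁} q₂ q₂.release_nonneg le_rfl] at hclose
  have hpos := (abs_lt.1 hclose).1
  have hlarge := (le_abs_self _).trans ((A.route (insert q₂ {q₁})).abs_pos_le q₂.release_nonneg)
  have h2 : insert q₂ {q₁} ∈ instances 2 T := insert_mem_instances h1 (by
    intro p hp
    rw [Finset.mem_singleton] at hp
    subst hp
    change 0 + T ≤ _
    linarith)
  by_cases hs2 : (A.route (insert q₂ {q₁})).Serves q₂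
  · exact Or.inr ⟨q₁, q₂, rfl, rfl, rfl, hloc, hwt, hrel, by linarith, by linarith, h2, hs2,
      fun h => hconf ⟨h, hs2⟩⟩
  · left
    have hne : q₂ ≠ q₁ := by
      intro h
      rw [h] at hloc
      change (1 : ℝ) = -1 at hloc
      norm_num at hloc
    have hsum : ∑ q ∈ insert q₂ ({q₁} : Instance), q.weight = 1 + w := by
      rw [Finset.sum_insert (by simpa using hne), Finset.sum_singleton, hwt, add_comm]
    rw [← hsum]
    have hall : ∀ p ∈ insert q₂ ({q₁} : Instance), (A.route (insert q₂ {q₁})).Serves p → p = q₁ := by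
      intro p hp hp'
      rw [Finset.mem_insert, Finset.mem_singleton] at hp
      rcases hp with rfl | rfl
      · exact absurd hp' hs2
      · rfl
    refine A.performance_le_of_single (instances_mono hn le_rfl h2) zero_le_one ?_ ?_
    · intro p hp q hq hp' hq'
      rw [hall p hp hp', hall q hq hq']
    · intro p hp hp'
      rw [hall p hp hp']

lemma eq_of_served_pair {x : Itinerary} {I : Instance} {a b : Request}
    (hab : ¬ (x.Serves a ∧ x.Serves b)) (h : ∀ p ∈ I, x.Serves p → p = a ∨ p = b) :
    ∀ p ∈ I, ∀ q ∈ I, x.Serves p → x.Serves q → p = q := by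
  intro p hp q hq hp' hq'
  rcases h p hp hp' with rfl | rfl <;> rcases h q hq hq' with rfl | rfl
  · rfl
  · exact absurd ⟨hp', hq'⟩ hab
  · exact absurd ⟨hq', hp'⟩ hab
  · rfl

open Classical in
-- The third request answers the second as the second answered the first. The vehicle is then near
-- `-1`, too late to return for `q₁`, so at most one of the three requests is served.
lemma OnlineAlgorithm.performance_three_le (A : OnlineAlgorithm) {T w : ℝ} (hT : 1 / 2 ≤ T)
    (hT' : T < 1) (hw : 1 ≤ w) (hw' : w * (1 + w) = 1 + 2 * w) :
    A.performance 3 T ≤ 1 / (1 + w) := by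
  have hw0 : 0 < w := by linarith
  obtain ⟨ε, hε, hε'⟩ : ∃ ε, 0 < ε ∧ ε + T < 1 := ⟨(1 - T) / 2, by linarith, by linarith⟩
  rcases A.exists_opening (n := 3) (by norm_num) hT hw0 hε hε' with h |
    ⟨q₁, q₂, hl₁, hr₁, hw₁, hl₂, hw₂, hr₂, -, hpos, hinst, hs₂, hs₁⟩
  · exact h
  obtain ⟨q₃, hl₃, hw₃, hr₃, hclose, hconf⟩ := A.exists_conflict {q₂, q₁} (m := q₂.release + T)
    hw0 hε (by rw [hl₂]; norm_num) (by linarith) hs₂ (by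
      intro s hs h
      have hsp := (A.route {q₂, q₁}).speed q₂.release s q₂.release_nonneg
        (q₂.release_nonneg.trans hs.1)
      rw [h, hl₂, abs_sub_comm q₂.release, abs_of_nonneg (sub_nonneg.2 hs.1)] at hsp
      linarith [(abs_le.1 hsp).2, hs.2])
  rw [hl₂, neg_neg] at hl₃
  rw [hl₂] at hclose
  have hs₁' : ¬ (A.route {q₃, q₂, q₁}).Serves q₁ := by
    refine Itinerary.not_serves_of_far _ (A.route {q₂, q₁}) q₃.release_nonneg
      (fun s hs hs' => A.route_insert_eq _ _ hs hs') hs₁ ?_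
    rw [hl₁, hr₁]
    refine lt_abs.2 (Or.inr ?_)
    linarith [(abs_lt.1 hclose).2]
  have hinst' : ({q₃, q₂, q₁} : Instance) ∈ instances 3 T := insert_mem_instances hinst (by
    simp only [Finset.mem_insert, Finset.mem_singleton, forall_eq_or_imp, forall_eq]
    constructor <;> linarith)
  have h₂₁ : q₂ ≠ q₁ := by rintro rfl; linarith
  have h₃₂ : q₃ ≠ q₂ := by rintro rfl; linarith
  have h₃₁ : q₃ ≠ q₁ := by rintro rfl; linarith
  have hsum : ∑ q ∈ ({q₃, q₂, q₁} : Instance), q.weight = w * (1 + w) := by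
    rw [Finset.sum_insert (by simp [h₃₂, h₃₁]), Finset.sum_pair h₂₁, hw₁, hw₂, hw₃]
    linarith
  have hbound := A.performance_le_of_single hinst' hw0.le (by
      refine eq_of_served_pair hconf ?_
      simp only [Finset.mem_insert, Finset.mem_singleton]
      rintro p (rfl | rfl | rfl) hp
      · exact Or.inr rfl
      · exact Or.inl rfl
      · exact absurd hp hs₁') (by
      simp only [Finset.mem_insert, Finset.mem_singleton]
      rintro p (rfl | rfl | rfl) _ <;> linarith)
  refine hbound.trans_eq ?_
  rw [hsum]
  field_simp

/-- If four requests have been released with weights `1, w, w, w` and the vehicle serves at most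
one of them, the performance is as claimed. -/
lemma OnlineAlgorithm.performance_four_le_of_single (A : OnlineAlgorithm) {T w : ℝ}
    (hw : 1 ≤ w) (hw' : w * (1 + w) = 1 + 3 * w) {I : Instance} (hI : I ∈ instances 4 T)
    (hsum : ∑ q ∈ I, q.weight = 1 + 3 * w)
    (hone : ∀ p ∈ I, ∀ q ∈ I, (A.route I).Serves p → (A.route I).Serves q → p = q)
    (hle : ∀ p ∈ I, p.weight ≤ w) : A.performance 4 T ≤ 1 / (1 + w) := by
  refine (A.performance_le_of_single hI (by linarith) hone fun p hp _ => hle p hp).trans_eq ?_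
  have : 0 < w := by linarith
  rw [hsum, ← hw']
  field_simp

open Classical in
lemma OnlineAlgorithm.performance_four_le (A : OnlineAlgorithm) {T w : ℝ} (hT : 1 / 2 ≤ T)
    (hT' : T < 1) (hw : 1 ≤ w) (hw' : w * (1 + w) = 1 + 3 * w) :
    A.performance 4 T ≤ 1 / (1 + w) := by
  have hw0 : 0 < w := by linarith
  obtain ⟨ε, hε, hε2⟩ : ∃ ε, 0 < ε ∧ 2 * ε + T = 1 := ⟨(1 - T) / 2, by linarith, by ring⟩
  rcases A.exists_opening (n := 4) (by norm_num) hT hw0 hε (by linarith) with h |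
    ⟨q₁, q₂, hl₁, hr₁, hw₁, hl₂, hw₂, hr₂, hlate, hpos, hinst, hs₂, hs₁⟩
  · exact h
  set z := A.route {q₂, q₁} with hz
  obtain ⟨t₃, ht₃, hz₃, hno₃⟩ : ∃ t₃, q₂.release + T ≤ t₃ ∧ z.pos t₃ = 0 ∧
      ∀ s ∈ Set.Icc q₂.release t₃, z.pos s ≠ q₂.loc := by
    -- Being within distance 1 of `-1` suffices: the vehicle is then left of the origin, whereas at
    -- time `q₂.release + T` it is still on the right because `1 - ε - T > 0`. The crossing `t₃`
    -- lies in between, before the first visit to `-1`.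
    obtain ⟨t, hmt, -, hclose, hnot⟩ := z.exists_before_hit (m := q₂.release + T)
      q₂.release_nonneg (by linarith) one_pos hs₂ (by
        intro s hs h
        have hsp := z.speed q₂.release s q₂.release_nonneg (q₂.release_nonneg.trans hs.1)
        rw [h, hl₂, abs_sub_comm q₂.release, abs_of_nonneg (sub_nonneg.2 hs.1)] at hsp
        linarith [(abs_le.1 hsp).2, hs.2])
    have hsp := z.speed q₂.release (q₂.release + T) q₂.release_nonneg (by linarith)
    rw [abs_sub_comm q₂.release, add_sub_cancel_left,
      abs_of_nonneg (by linarith : (0 : ℝ) ≤ T)] at hsp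
    rw [hl₂] at hclose
    obtain ⟨t₃, ht₃, h0⟩ := intermediate_value_Icc' hmt
      (z.continuousOn.mono fun s hs => show (0 : ℝ) ≤ s by linarith [hs.1])
      (show (0 : ℝ) ∈ Set.Icc (z.pos t) (z.pos (q₂.release + T)) from
        ⟨by linarith [(abs_lt.1 hclose).2], by linarith [(abs_le.1 hsp).2]⟩)
    exact ⟨t₃, ht₃.1, h0, fun s hs => hnot s ⟨hs.1, hs.2.trans ht₃.2⟩⟩
  obtain ⟨q₃, hl₃, hr₃, hw₃⟩ : ∃ q : Request, q.loc = 1 ∧ q.release = t₃ ∧ q.weight = w :=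
    ⟨⟨1, t₃, w, by norm_num, by linarith, hw0⟩, rfl, rfl, rfl⟩
  subst hr₃
  set u := A.route {q₃, q₂, q₁} with hu
  have huz : ∀ s, 0 ≤ s → s ≤ q₃.release → u.pos s = z.pos s := fun s hs hs' =>
    A.route_insert_eq _ _ hs hs'
  have hu₃ : u.pos q₃.release = 0 := by rw [huz _ q₃.release_nonneg le_rfl, hz₃]
  have hu₁ : ¬ u.Serves q₁ := by
    refine u.not_serves_of_far z q₃.release_nonneg huz hs₁ ?_
    rw [hl₁, hr₁, hz₃]
    norm_num
    linarith
  have hconf : ¬ (u.Serves q₂ ∧ u.Serves q₃) := by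
    refine u.not_serves_both (by rw [hl₂, hl₃]; norm_num) (by linarith) fun s hs => ?_
    rw [huz s (q₂.release_nonneg.trans hs.1) hs.2]
    exact hno₃ s hs
  have hfree : ∀ s ∈ Set.Icc q₃.release (q₃.release + T), |u.pos s| < 1 := by
    intro s hs
    have hsp := u.speed s q₃.release (q₃.release_nonneg.trans hs.1) q₃.release_nonneg
    rw [hu₃, sub_zero, abs_of_nonneg (sub_nonneg.2 hs.1)] at hsp
    linarith [hs.2]
  have hinst' : ({q₃, q₂, q₁} : Instance) ∈ instances 3 T := insert_mem_instances hinst (by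
    simp only [Finset.mem_insert, Finset.mem_singleton, forall_eq_or_imp, forall_eq]
    constructor <;> linarith)
  have h₂₁ : q₂ ≠ q₁ := by rintro rfl; linarith
  have h₃₂ : q₃ ≠ q₂ := by rintro rfl; linarith
  have h₃₁ : q₃ ≠ q₁ := by rintro rfl; linarith
  have hextend : ∀ q₄ : Request, q₃.release + T ≤ q₄.release → q₄.weight = w →
      ({q₄, q₃, q₂, q₁} : Instance) ∈ instances 4 T ∧
      ∑ q ∈ ({q₄, q₃, q₂, q₁} : Instance), q.weight = 1 + 3 * w := by
    intro q₄ hr₄ hw₄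
    have h₄₃ : q₄ ≠ q₃ := by rintro rfl; linarith
    have h₄₂ : q₄ ≠ q₂ := by rintro rfl; linarith
    have h₄₁ : q₄ ≠ q₁ := by rintro rfl; linarith
    refine ⟨insert_mem_instances hinst' ?_, ?_⟩
    · simp only [Finset.mem_insert, Finset.mem_singleton, forall_eq_or_imp, forall_eq]
      refine ⟨?_, ?_, ?_⟩ <;> linarith
    · rw [Finset.sum_insert (by simp [h₄₃, h₄₂, h₄₁]), Finset.sum_insert (by simp [h₃₂, h₃₁]),
        Finset.sum_pair h₂₁, hw₁, hw₂, hw₃, hw₄]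
      ring
  by_cases hu₂ : u.Serves q₂
  · have hu₃' : ¬ u.Serves q₃ := fun h => hconf ⟨hu₂, h⟩
    obtain ⟨q₄, hl₄, hw₄, hr₄, hclose, hconf₄⟩ := A.exists_conflict {q₃, q₂, q₁}
      (m := q₃.release + T) hw0 hε (by rw [hl₂]; norm_num) (by linarith) hu₂ (by
        intro s hs h
        rcases le_total s q₃.release with hle | hle
        · exact hno₃ s ⟨hs.1, hle⟩ (by rw [← huz s (q₂.release_nonneg.trans hs.1) hle]; exact h)
        · have := hfree s ⟨hle, hs.2⟩
          rw [hu, h, hl₂] at this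
          norm_num at this)
    obtain ⟨hI, hsum⟩ := hextend q₄ hr₄ hw₄
    -- The end `1` is more than `2 - ε` away, while at most `2 - T` is left of these windows, and `ε
    -- < T`.
    have hlost : ∀ p : Request, p.loc = 1 → p.release ≤ q₃.release → ¬ u.Serves p →
        ¬ (A.route {q₄, q₃, q₂, q₁}).Serves p := by
      intro p hp hpr hpu
      refine Itinerary.not_serves_of_far _ u q₄.release_nonneg
        (fun s hs hs' => A.route_insert_eq _ _ hs hs') hpu ?_
      rw [hl₂] at hclose
      rw [hp]
      refine lt_abs.2 (Or.inr ?_)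
      linarith [(abs_lt.1 hclose).2]
    have hn₁ := hlost q₁ hl₁ (by linarith) hu₁
    have hn₃ := hlost q₃ hl₃ le_rfl hu₃'
    refine A.performance_four_le_of_single hw hw' hI hsum ?_ ?_
    · refine eq_of_served_pair hconf₄ ?_
      simp only [Finset.mem_insert, Finset.mem_singleton]
      rintro p (rfl | rfl | rfl | rfl) hp
      · exact Or.inr rfl
      · exact absurd hp hn₃
      · exact Or.inl rfl
      · exact absurd hp hn₁
    · simp only [Finset.mem_insert, Finset.mem_singleton]
      rintro p (rfl | rfl | rfl | rfl) <;> linarith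
  by_cases hu₃' : u.Serves q₃
  · obtain ⟨q₄, hl₄, hw₄, hr₄, hclose, hconf₄⟩ := A.exists_conflict {q₃, q₂, q₁}
      (m := q₃.release + T) hw0 hε (by rw [hl₃]; norm_num) (by linarith) hu₃' (by
        intro s hs h
        have := hfree s hs
        rw [hu, h, hl₃] at this
        norm_num at this)
    obtain ⟨hI, hsum⟩ := hextend q₄ hr₄ hw₄
    change |u.pos q₄.release - q₃.loc| < ε at hclose
    rw [hl₃] at hclose
    have harrive : q₃.release + (1 - ε) < q₄.release := by
      have hsp := u.speed q₄.release q₃.release q₄.release_nonneg q₃.release_nonneg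
      rw [hu₃, sub_zero, abs_of_nonneg (by linarith : 0 ≤ q₄.release - q₃.release)] at hsp
      linarith [(abs_le.1 hsp).2, (abs_lt.1 hclose).1]
    -- The window of `q₁` has closed: `q₄.release > (1 - ε) + T + (1 - ε) = 1 + 2 * T ≥ 2`.
    have hn₁ : ¬ (A.route {q₄, q₃, q₂, q₁}).Serves q₁ := by
      refine Itinerary.not_serves_of_far _ u q₄.release_nonneg
        (fun s hs hs' => A.route_insert_eq _ _ hs hs') hu₁ (lt_of_lt_of_le ?_ (abs_nonneg _))
      linarith
    have hn₂ : ¬ (A.route {q₄, q₃, q₂, q₁}).Serves q₂ := by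
      refine Itinerary.not_serves_of_far _ u q₄.release_nonneg
        (fun s hs hs' => A.route_insert_eq _ _ hs hs') hu₂ ?_
      rw [hl₂]
      refine lt_abs.2 (Or.inl ?_)
      linarith [(abs_lt.1 hclose).1]
    refine A.performance_four_le_of_single hw hw' hI hsum ?_ ?_
    · refine eq_of_served_pair hconf₄ ?_
      simp only [Finset.mem_insert, Finset.mem_singleton]
      rintro p (rfl | rfl | rfl | rfl) hp
      · exact Or.inr rfl
      · exact Or.inl rfl
      · exact absurd hp hn₂
      · exact absurd hp hn₁
    · simp only [Finset.mem_insert, Finset.mem_singleton]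
      rintro p (rfl | rfl | rfl | rfl) <;> linarith
  · have hnone : ∀ p ∈ ({q₃, q₂, q₁} : Instance), ¬ u.Serves p := by
      simp only [Finset.mem_insert, Finset.mem_singleton]
      rintro p (rfl | rfl | rfl) <;> assumption
    refine (A.performance_le_of_single (m := 0) (instances_mono (by norm_num) le_rfl hinst') le_rfl
      (fun p hp _ _ h _ => absurd h (hnone p hp)) (fun p hp h => absurd h (hnone p hp))).trans ?_
    rw [zero_div]
    positivity

/-! ### The greedy algorithm -/

/-- The itinerary that never leaves the origin. -/
def Itinerary.rest : Itinerary where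
  pos _ := 0
  start := rfl
  mem _ _ := by norm_num
  speed s t _ _ := by simp

/-- The position reached from `p` by moving for time `τ` at unit speed towards `A`, and waiting
there after arrival. -/
noncomputable def approach (p A τ : ℝ) : ℝ := max (p - τ) (min (p + τ) A)

lemma approach_zero (p A : ℝ) : approach p A 0 = p := by
  simp [approach]

lemma approach_eq {p A τ : ℝ} (h : |A - p| ≤ τ) : approach p A τ = A := by
  rw [abs_le] at h
  rw [approach, min_eq_right (by linarith), max_eq_right (by linarith)]

lemma approach_mem {p A τ : ℝ} (hp : p ∈ Set.Icc (-1 : ℝ) 1) (hA : A ∈ Set.Icc (-1 : ℝ) 1)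
    (hτ : 0 ≤ τ) : approach p A τ ∈ Set.Icc (-1 : ℝ) 1 :=
  ⟨le_max_of_le_right (le_min (by linarith [hp.1]) hA.1),
    max_le (by linarith [hp.2]) ((min_le_right _ _).trans hA.2)⟩

lemma abs_approach_sub_le (p A σ τ : ℝ) : |approach p A σ - approach p A τ| ≤ |σ - τ| := by
  refine (abs_max_sub_max_le_max _ _ _ _).trans (max_le ?_ ?_)
  · rw [show p - σ - (p - τ) = -(σ - τ) by ring, abs_neg]
  · refine (abs_min_sub_min_le_max _ _ _ _).trans (max_le ?_ ?_)
    · rw [show p + σ - (p + τ) = σ - τ by ring]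
    · simp

/-- Follow `x` until time `r`, then go to `A` and wait there. -/
noncomputable def Itinerary.redirect (x : Itinerary) (r A : ℝ) (hr : 0 ≤ r)
    (hA : A ∈ Set.Icc (-1 : ℝ) 1) : Itinerary where
  -- Clamping avoids a case split: up to `r` the travel time is 0, afterwards the starting point is
  -- frozen at `x.pos r`.
  pos t := approach (x.pos (min t r)) A (max t r - r)
  start := by simp [hr, x.start, approach_zero]
  mem t ht := approach_mem (x.mem _ (le_min ht hr)) hA (sub_nonneg.2 (le_max_right _ _))
  speed := by
    have key : ∀ s t, 0 ≤ s → s ≤ t →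
        |approach (x.pos (min s r)) A (max s r - r) -
          approach (x.pos (min t r)) A (max t r - r)| ≤ t - s := by
      intro s t hs hst
      rcases le_total t r with htr | htr
      · rw [min_eq_left htr, min_eq_left (hst.trans htr), max_eq_right htr,
          max_eq_right (hst.trans htr), sub_self, approach_zero, approach_zero]
        refine (x.speed s t hs (hs.trans hst)).trans_eq ?_
        rw [abs_sub_comm, abs_of_nonneg (sub_nonneg.2 hst)]
      rcases le_total s r with hsr | hsr
      · rw [min_eq_left hsr, min_eq_right htr, max_eq_right hsr, max_eq_left htr, sub_self,
          approach_zero]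
        have h1 := x.speed s r hs hr
        have h2 := abs_approach_sub_le (x.pos r) A 0 (t - r)
        rw [approach_zero] at h2
        rw [abs_sub_comm s, abs_of_nonneg (sub_nonneg.2 hsr)] at h1
        rw [abs_sub_comm 0, sub_zero, abs_of_nonneg (sub_nonneg.2 htr)] at h2
        linarith [abs_sub_le (x.pos s) (x.pos r) (approach (x.pos r) A (t - r))]
      · rw [min_eq_right htr, min_eq_right hsr, max_eq_left htr, max_eq_left hsr]
        refine (abs_approach_sub_le _ _ _ _).trans_eq ?_
        rw [abs_sub_comm, abs_of_nonneg (by linarith)]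
        ring
    intro s t hs ht
    rcases le_total s t with h | h
    · rw [abs_sub_comm s, abs_of_nonneg (sub_nonneg.2 h)]
      exact key s t hs h
    · rw [abs_sub_comm, abs_of_nonneg (sub_nonneg.2 h)]
      exact key t s ht h

lemma Itinerary.redirect_of_le (x : Itinerary) {r A : ℝ} (hr : 0 ≤ r)
    (hA : A ∈ Set.Icc (-1 : ℝ) 1) {t : ℝ} (ht : t ≤ r) : (x.redirect r A hr hA).pos t = x.pos t := by
  simp [redirect, ht, approach_zero]

lemma Itinerary.redirect_arrived (x : Itinerary) {r A : ℝ} (hr : 0 ≤ r)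
    (hA : A ∈ Set.Icc (-1 : ℝ) 1) {t : ℝ} (ht : r + |A - x.pos r| ≤ t) :
    (x.redirect r A hr hA).pos t = A := by
  have hrt : r ≤ t := by linarith [abs_nonneg (A - x.pos r)]
  simp only [redirect, min_eq_right hrt, max_eq_left hrt]
  exact approach_eq (by linarith)

/-- The segment is no longer than the window, so leaving at the release time always suffices. -/
lemma Itinerary.redirect_serves (x : Itinerary) (q : Request) :
    (x.redirect q.release q.loc q.release_nonneg q.loc_mem).Serves q := by
  refine ⟨q.release + 2, ⟨by linarith, le_rfl⟩, x.redirect_arrived _ _ ?_⟩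
  have h := x.mem q.release q.release_nonneg
  have h' := q.loc_mem
  have : |q.loc - x.pos q.release| ≤ 2 := abs_le.2 ⟨by linarith [h.2, h'.1], by linarith [h.1, h'.2]⟩
  linarith

/-- The state of the greedy algorithm: the planned itinerary, its current destination, and the
weight that a new request must exceed in order to replace a destination not yet reached. -/
structure GreedyState where
  route : Itinerary
  target : ℝ
  bar : ℝ

open Classical in
/-- The reaction to a new request: it becomes the destination if the current one has been reached
or if its weight exceeds the bar. The new bar is its weight times the factor `v`. -/
noncomputable def GreedyState.step (v : ℝ) (S : GreedyState) (q : Request) : GreedyState :=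
  if S.route.pos q.release = S.target ∨ S.bar < q.weight then
    ⟨S.route.redirect q.release q.loc q.release_nonneg q.loc_mem, q.loc, v * q.weight⟩
  else S

lemma GreedyState.step_of (v : ℝ) (S : GreedyState) (q : Request)
    (h : S.route.pos q.release = S.target ∨ S.bar < q.weight) : S.step v q =
      ⟨S.route.redirect q.release q.loc q.release_nonneg q.loc_mem, q.loc, v * q.weight⟩ :=
  if_pos h

lemma GreedyState.step_of_not (v : ℝ) (S : GreedyState) (q : Request)
    (h : ¬ (S.route.pos q.release = S.target ∨ S.bar < q.weight)) : S.step v q = S :=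
  if_neg h

lemma GreedyState.step_pos_of_le (v : ℝ) (S : GreedyState) (q : Request) {t : ℝ}
    (ht : t ≤ q.release) : (S.step v q).route.pos t = S.route.pos t := by
  by_cases h : S.route.pos q.release = S.target ∨ S.bar < q.weight
  · rw [S.step_of v q h]
    exact S.route.redirect_of_le q.release_nonneg q.loc_mem ht
  · rw [S.step_of_not v q h]

/-- A request of the instance that is released last. -/
noncomputable def lastRequest (I : Instance) (hI : I.Nonempty) : Request :=
  (I.exists_max_image Request.release hI).choose

lemma lastRequest_mem {I : Instance} (hI : I.Nonempty) : lastRequest I hI ∈ I :=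
  (I.exists_max_image Request.release hI).choose_spec.1

lemma release_le_lastRequest {I : Instance} (hI : I.Nonempty) {q : Request} (hq : q ∈ I) :
    q.release ≤ (lastRequest I hI).release :=
  (I.exists_max_image Request.release hI).choose_spec.2 q hq

open Classical in
/-- The state of the greedy algorithm after the requests of `I`; the bar for replacing the first
request carries the factor `w`. -/
noncomputable def greedyState (w : ℝ) (I : Instance) : GreedyState :=
  if hI : I.Nonempty then
    (greedyState w (I.erase (lastRequest I hI))).step
      (if I.erase (lastRequest I hI) = ∅ then w else 1) (lastRequest I hI)
  -- The target is the resting position, so the first request always counts as arriving at a reached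
  -- destination and is accepted.
  else ⟨Itinerary.rest, 0, 0⟩
termination_by I.card
decreasing_by exact Finset.card_erase_lt_of_mem (lastRequest_mem hI)

open Classical in
lemma greedyState_of_nonempty (w : ℝ) {I : Instance} (hI : I.Nonempty) :
    greedyState w I = (greedyState w (I.erase (lastRequest I hI))).step
      (if I.erase (lastRequest I hI) = ∅ then w else 1) (lastRequest I hI) := by
  rw [greedyState, dif_pos hI]

lemma greedyState_empty (w : ℝ) : greedyState w ∅ = ⟨Itinerary.rest, 0, 0⟩ := by
  rw [greedyState, dif_neg (by simp)]

open Classical in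
-- This is the online property: peeling off a last request released after `t` changes the route only
-- after `t`.
lemma greedyState_revealed (w : ℝ) (I : Instance) (t : ℝ) {s : ℝ} (hs : s ≤ t) :
    (greedyState w I).route.pos s = (greedyState w (revealed I t)).route.pos s := by
  induction hn : I.card using Nat.strong_induction_on generalizing I with
  | _ n ih =>
    subst hn
    by_cases hall : ∀ q ∈ I, q.release ≤ t
    · rw [revealed, Finset.filter_true_of_mem hall]
    push Not at hall
    obtain ⟨p, hp, hpt⟩ := hall
    have hI : I.Nonempty := ⟨p, hp⟩
    have hlast := hpt.trans_le (release_le_lastRequest hI hp)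
    have hrev : revealed (I.erase (lastRequest I hI)) t = revealed I t := by
      conv_rhs => rw [← Finset.insert_erase (lastRequest_mem hI)]
      rw [revealed_insert_of_lt _ hlast]
    rw [greedyState_of_nonempty w hI, GreedyState.step_pos_of_le _ _ _ (hs.trans hlast.le),
      ih _ (Finset.card_erase_lt_of_mem (lastRequest_mem hI)) _ rfl, hrev]

/-- The greedy algorithm. -/
noncomputable def greedy (w : ℝ) : OnlineAlgorithm where
  route I := (greedyState w I).route
  online I J t h s _ hst := by
    rw [greedyState_revealed w I t hst, greedyState_revealed w J t hst, h]

/-! ### Analysis of the greedy algorithm -/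

/-- The request `p` is served no later than the last release of the instance. -/
def Itinerary.ServesEarly (x : Itinerary) (J : Instance) (p : Request) : Prop :=
  ∃ s ∈ Set.Icc p.release (p.release + 2), x.pos s = p.loc ∧ ∃ q ∈ J, s ≤ q.release

lemma Itinerary.ServesEarly.serves {x : Itinerary} {J : Instance} {p : Request}
    (h : x.ServesEarly J p) : x.Serves p :=
  let ⟨s, hs, hx, _⟩ := h
  ⟨s, hs, hx⟩

open Classical in
-- A step alters positions only after `q.release`, so a visit made by then is final, unlike a merely
-- planned one.
lemma Itinerary.ServesEarly.step {S : GreedyState} {J : Instance} {p : Request}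
    (h : S.route.ServesEarly J p) (v : ℝ) {q : Request} (hq : ∀ p ∈ J, p.release ≤ q.release) :
    (S.step v q).route.ServesEarly (insert q J) p := by
  obtain ⟨s, hs, hx, p', hp', hsp⟩ := h
  refine ⟨s, hs, ?_, p', Finset.mem_insert_of_mem hp', hsp⟩
  rw [S.step_pos_of_le v q (hsp.trans (hq p' hp')), hx]

open Classical in
/-- A planned visit of the destination has already taken place if the destination is reached when
a new request is released. -/
lemma servesEarly_step_of_target {S : GreedyState} {J : Instance} {p : Request} {q : Request}
    (v : ℝ) (ht : S.target = p.loc) (hp : S.route.Serves p) (hpq : p.release ≤ q.release)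
    (hreach : S.route.pos q.release = S.target) :
    (S.step v q).route.ServesEarly (insert q J) p := by
  obtain ⟨s, hs, hx⟩ := hp
  rcases le_total s q.release with h | h
  · exact ⟨s, hs, by rw [S.step_pos_of_le v q h, hx], q, Finset.mem_insert_self _ _, h⟩
  · exact ⟨q.release, ⟨hpq, h.trans hs.2⟩, by
      rw [S.step_pos_of_le v q le_rfl, hreach, ht], q, Finset.mem_insert_self _ _, le_rfl⟩

/-- A heaviest request of `R` is served early, or it is the current destination. -/
def GreedyState.Secures (S : GreedyState) (J R : Instance) : Prop :=
  ∃ p ∈ R, (∀ q ∈ R, q.weight ≤ p.weight) ∧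
    ((S.route.ServesEarly J p ∧ S.bar ≤ p.weight) ∨
      (S.target = p.loc ∧ S.bar = p.weight ∧ S.route.Serves p))

lemma GreedyState.secures_singleton (S : GreedyState) (J : Instance) (q : Request)
    (h : S.route.pos q.release = S.target ∨ S.bar < q.weight) :
    (S.step 1 q).Secures J {q} := by
  refine ⟨q, Finset.mem_singleton_self q, by simp, Or.inr ?_⟩
  rw [S.step_of 1 q h]
  exact ⟨rfl, one_mul _, S.route.redirect_serves q⟩

open Classical in
-- The bar never exceeds the weight of the heaviest `p`, so a heavier newcomer always takes over.
-- Any other newcomer replaces `p` as destination only after `p` has been reached, hence served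
-- early.
lemma GreedyState.Secures.step {S : GreedyState} {J R : Instance} (h : S.Secures J R)
    (hRJ : R ⊆ J) {q : Request} (hq : ∀ p ∈ J, p.release ≤ q.release) :
    (S.step 1 q).Secures (insert q J) (insert q R) := by
  obtain ⟨p, hpR, hmax, hp⟩ := h
  have hbar : S.bar ≤ p.weight := hp.elim And.right fun h => h.2.1.le
  by_cases hwt : p.weight < q.weight
  · refine ⟨q, Finset.mem_insert_self _ _, ?_, Or.inr ?_⟩
    · rw [Finset.forall_mem_insert]
      exact ⟨le_rfl, fun a ha => (hmax a ha).trans hwt.le⟩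
    · rw [S.step_of 1 q (Or.inr (hbar.trans_lt hwt))]
      exact ⟨rfl, one_mul _, S.route.redirect_serves q⟩
  rw [not_lt] at hwt
  refine ⟨p, Finset.mem_insert_of_mem hpR, ?_, ?_⟩
  · rw [Finset.forall_mem_insert]
    exact ⟨hwt, hmax⟩
  have hbar' : (S.step 1 q).bar ≤ p.weight := by
    by_cases ht : S.route.pos q.release = S.target ∨ S.bar < q.weight
    · rw [S.step_of 1 q ht]
      simpa using hwt
    · rwa [S.step_of_not 1 q ht]
  rcases hp with ⟨hp, -⟩ | ⟨ht, hb, hs⟩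
  · exact Or.inl ⟨hp.step 1 hq, hbar'⟩
  by_cases hreach : S.route.pos q.release = S.target
  · exact Or.inl ⟨servesEarly_step_of_target 1 ht hs (hq p (hRJ hpR)) hreach, hbar'⟩
  · rw [S.step_of_not 1 q (by rw [hb]; exact not_or.2 ⟨hreach, not_lt.2 hwt⟩)]
    exact Or.inr ⟨ht, hb, hs⟩

open Classical in
/-- The favourable situation: a heaviest request among those in `R` is secured, and the remaining
requests are paid for by a request served early or by a heavy one in `R`. -/
def GreedyState.Favourable (w : ℝ) (S : GreedyState) (J : Instance) : Prop :=
  ∃ R ⊂ J, S.Secures J R ∧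
    ((∃ p ∈ J \ R, S.route.ServesEarly J p ∧
        ∑ q ∈ J \ R, q.weight ≤ (1 + w) * p.weight) ∨
      ∃ b ∈ R, w * ∑ q ∈ J \ R, q.weight ≤ b.weight)

open Classical in
-- Newcomers join `R`, so `J \ R` is frozen, and later requests undo neither an early service nor a
-- weight in `R`.
lemma GreedyState.Favourable.step {w : ℝ} {S : GreedyState} {J : Instance}
    (h : S.Favourable w J) {q : Request} (hqJ : q ∉ J) (hq : ∀ p ∈ J, p.release ≤ q.release) :
    (S.step 1 q).Favourable w (insert q J) := by
  obtain ⟨R, hRJ, hsec, hpay⟩ := h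
  have hsd : insert q J \ insert q R = J \ R := by
    rw [Finset.insert_sdiff_insert, Finset.sdiff_insert, Finset.erase_eq_of_notMem]
    exact fun h => hqJ (Finset.mem_sdiff.1 h).1
  refine ⟨insert q R, ?_, hsec.step hRJ.subset hq, ?_⟩
  · obtain ⟨a, haJ, haR⟩ := Finset.exists_of_ssubset hRJ
    refine Finset.ssubset_iff_of_subset (Finset.insert_subset_insert _ hRJ.subset) |>.2
      ⟨a, Finset.mem_insert_of_mem haJ, ?_⟩
    rw [Finset.mem_insert, not_or]
    exact ⟨fun h => hqJ (h ▸ haJ), haR⟩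
  rw [hsd]
  rcases hpay with ⟨p, hp, hserve, hle⟩ | ⟨b, hb, hle⟩
  · exact Or.inl ⟨p, hp, hserve.step 1 hq, hle⟩
  · exact Or.inr ⟨b, Finset.mem_insert_of_mem hb, hle⟩

open Classical in
/-- In a favourable situation the served requests carry enough weight. -/
lemma GreedyState.Favourable.total_le {w : ℝ} (hw : 0 < w) {n : ℕ}
    (hn : w * (1 + w) = 1 + (n - 1) * w) {S : GreedyState} {J : Instance}
    (h : S.Favourable w J) (hJ : J.card ≤ n) :
    ∑ q ∈ J, q.weight ≤ (1 + w) * ∑ q ∈ J with S.route.Serves q, q.weight := by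
  obtain ⟨R, hRJ, ⟨p, hpR, hmax, hp⟩, hpay⟩ := h
  have hps : S.route.Serves p := hp.elim (fun h => h.1.serves) fun h => h.2.2
  have hcard : (R.card : ℝ) ≤ n - 1 := by
    have : R.card + 1 ≤ n := (Finset.card_lt_card hRJ).trans_le hJ
    have : ((R.card + 1 : ℕ) : ℝ) ≤ n := by exact_mod_cast this
    push_cast at this
    linarith
  have hR : ∑ q ∈ R, q.weight ≤ (n - 1) * p.weight := by
    refine (Finset.sum_le_card_nsmul R _ p.weight hmax).trans ?_
    rw [nsmul_eq_mul]
    exact mul_le_mul_of_nonneg_right hcard p.weight_pos.le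
  have htotal := Finset.sum_sdiff hRJ.subset (f := fun q : Request => q.weight)
  have hn' : w * ((n : ℝ) - 1) = w * (1 + w) - 1 := by linarith
  -- With `R.card ≤ n - 1`, this lets `p` pay for all of `R` when another served request `a` pays
  -- for the rest.
  have hwn : (n : ℝ) - 1 ≤ 1 + w := by
    refine le_of_mul_le_mul_left ?_ hw
    linarith
  have hpw := p.weight_pos
  rcases hpay with ⟨a, ha, hserve, hle⟩ | ⟨b, hb, hle⟩
  · rw [Finset.mem_sdiff] at ha
    have hne : a ≠ p := fun h => ha.2 (h ▸ hpR)
    have hsub : ({a, p} : Finset Request) ⊆ J.filter fun q => S.route.Serves q := by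
      intro q hq
      rw [Finset.mem_insert, Finset.mem_singleton] at hq
      rw [Finset.mem_filter]
      rcases hq with rfl | rfl
      · exact ⟨ha.1, hserve.serves⟩
      · exact ⟨hRJ.subset hpR, hps⟩
    have h2 := Finset.sum_le_sum_of_subset_of_nonneg hsub
      fun (q : Request) _ _ => q.weight_pos.le
    rw [Finset.sum_pair hne] at h2
    have h3 := mul_le_mul_of_nonneg_left h2 (by linarith : 0 ≤ 1 + w)
    have h4 := mul_le_mul_of_nonneg_right hwn hpw.le
    linarith
  -- Here `p` pays for everything: `w` times the total is at most `b.weight + w * (n - 1) * p.weight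
  -- ≤ w * (1 + w) * p.weight`, which is where the equation for `w` is sharp.
  · have hmem : p ∈ J.filter fun q => S.route.Serves q :=
      Finset.mem_filter.2 ⟨hRJ.subset hpR, hps⟩
    have h2 := Finset.single_le_sum (f := fun q : Request => q.weight)
      (fun q _ => q.weight_pos.le) hmem
    have h3 := mul_le_mul_of_nonneg_left h2 (by linarith : 0 ≤ 1 + w)
    refine le_trans ?_ h3
    refine le_of_mul_le_mul_left ?_ hw
    have h4 := mul_le_mul_of_nonneg_left hR hw.le
    have h5 := hmax b hb
    rw [← htotal, mul_add]
    have h6 : w * ((n - 1) * p.weight) = (w * (1 + w) - 1) * p.weight := by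
      rw [← mul_assoc, hn']
    linarith

open Classical in
/-- All situations that occur for instances with delay at least `1 / 2`. -/
lemma greedyState_cases {w : ℝ} (hw : 0 ≤ w) (I : Instance) (hI : I.Nonempty)
    (hdelay : ∀ p ∈ I, ∀ q ∈ I, p ≠ q → (1 / 2 : ℝ) ≤ |p.release - q.release|) :
    (∃ p, I = {p} ∧ greedyState w I =
      ⟨Itinerary.rest.redirect p.release p.loc p.release_nonneg p.loc_mem, p.loc,
        w * p.weight⟩) ∨
    (∃ p q, I = {q, p} ∧ q ≠ p ∧ p.release + 1 / 2 ≤ q.release ∧ q.weight ≤ w * p.weight ∧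
      greedyState w I =
        ⟨Itinerary.rest.redirect p.release p.loc p.release_nonneg p.loc_mem, p.loc,
          w * p.weight⟩) ∨
    (greedyState w I).Favourable w I := by
  induction hn : I.card using Nat.strong_induction_on generalizing I with
  | _ n ih =>
    subst hn
    set q := lastRequest I hI with hq
    set J := I.erase q with hJ
    have hqI : q ∈ I := lastRequest_mem hI
    have hIJ : I = insert q J := (Finset.insert_erase hqI).symm
    have hqJ : q ∉ J := Finset.notMem_erase _ _
    have hstate := greedyState_of_nonempty w hI
    rw [← hq, ← hJ] at hstate
    rcases J.eq_empty_or_nonempty with hJe | hJne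
    · left
      refine ⟨q, by rw [hIJ, hJe]; rfl, ?_⟩
      rw [hstate, if_pos hJe, hJe, greedyState_empty, GreedyState.step_of]
      exact Or.inl rfl
    have hgap : ∀ p ∈ J, p.release + 1 / 2 ≤ q.release := by
      intro p hp
      have hpI := Finset.mem_of_mem_erase hp
      have h1 := hdelay p hpI q hqI (Finset.ne_of_mem_erase hp)
      have h2 : p.release ≤ q.release := release_le_lastRequest hI hpI
      rw [abs_sub_comm, abs_of_nonneg (sub_nonneg.2 h2)] at h1
      linarith
    have hbefore : ∀ p ∈ J, p.release ≤ q.release := fun p hp => by linarith [hgap p hp]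
    rw [if_neg hJne.ne_empty] at hstate
    have harrive : ∀ (p : Request) (t : ℝ), p.release + 1 ≤ t →
        (Itinerary.rest.redirect p.release p.loc p.release_nonneg p.loc_mem).pos t = p.loc := by
      intro p t ht
      refine Itinerary.redirect_arrived _ _ _ ?_
      have : |p.loc - Itinerary.rest.pos p.release| ≤ 1 := by
        change |p.loc - 0| ≤ 1
        rw [sub_zero]
        exact abs_le.2 p.loc_mem
      linarith
    rcases ih J.card (Finset.card_erase_lt_of_mem hqI) J hJne
        (fun a ha b hb => hdelay a (Finset.mem_of_mem_erase ha) b (Finset.mem_of_mem_erase hb))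
        rfl with ⟨p, hJp, hS⟩ | ⟨p, p', hJp, hne, hpp', hwt, hS⟩ | hfav
    · right
      have hne : q ≠ p := by
        rintro h
        exact hqJ (by rw [hJp, h]; exact Finset.mem_singleton_self _)
      have hsd : insert q ({p} : Instance) \ {q} = {p} := by
        ext a
        simp only [Finset.mem_sdiff, Finset.mem_insert, Finset.mem_singleton]
        constructor
        · tauto
        · rintro rfl
          exact ⟨Or.inr rfl, hne.symm⟩
      by_cases htest : (greedyState w J).route.pos q.release = (greedyState w J).target ∨
          (greedyState w J).bar < q.weight
      · right
        rw [hstate, hIJ]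
        -- Either `p` has been reached and pays for itself, or it is dropped for a `q` heavier than
        -- `w * p.weight`.
        refine ⟨{q}, ?_, (greedyState w J).secures_singleton _ q htest, ?_⟩
        · rw [hJp, Finset.ssubset_iff_of_subset (by simp)]
          exact ⟨p, by simp, by simpa using hne.symm⟩
        rw [hJp, hsd, Finset.sum_singleton]
        rcases htest with hreach | hbar
        · left
          refine ⟨p, Finset.mem_singleton_self p, ?_, ?_⟩
          · rw [← hJp]
            refine servesEarly_step_of_target 1 (by rw [hS]) ?_
              (hbefore p (by rw [hJp]; exact Finset.mem_singleton_self p)) hreach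
            rw [hS]
            exact Itinerary.redirect_serves _ _
          · nlinarith [p.weight_pos]
        · right
          rw [hS] at hbar
          exact ⟨q, Finset.mem_singleton_self q, hbar.le⟩
      · left
        refine ⟨p, q, by rw [hIJ, hJp], hne,
          hgap p (by rw [hJp]; exact Finset.mem_singleton_self p), ?_, ?_⟩
        · rw [not_or, hS] at htest
          exact not_lt.1 htest.2
        · rw [hstate, GreedyState.step_of_not _ _ _ htest, hS]
    · right; right
      have hpJ : p ∈ J := by rw [hJp]; simp
      have hp'J : p' ∈ J := by rw [hJp]; simp
      -- Two delays of at least `1 / 2` cover the distance of at most 1 from the origin to `p`.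
      have hreach : (greedyState w J).route.pos q.release = (greedyState w J).target := by
        rw [hS]
        exact harrive p _ (by linarith [hgap p' hp'J])
      have hsd : insert q J \ {q} = J := by
        rw [Finset.insert_sdiff_of_mem _ (Finset.mem_singleton_self q),
          Finset.sdiff_singleton_eq_erase, Finset.erase_eq_of_notMem hqJ]
      rw [hstate, hIJ]
      refine ⟨{q}, ?_, (greedyState w J).secures_singleton _ q (Or.inl hreach), Or.inl ?_⟩
      · rw [Finset.ssubset_iff_of_subset (by simp)]
        exact ⟨p, by simp [hpJ], by
          rw [Finset.mem_singleton]
          exact fun h => hqJ (h ▸ hpJ)⟩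
      rw [hsd]
      -- The ignored `p'` weighs at most `w * p.weight`, so `p` pays for both.
      refine ⟨p, hpJ, servesEarly_step_of_target 1 (by rw [hS]) ?_ (hbefore p hpJ) hreach, ?_⟩
      · rw [hS]
        exact Itinerary.redirect_serves _ _
      · rw [hJp, Finset.sum_pair hne]
        linarith
    · right; right
      rw [hstate, hIJ]
      exact hfav.step hqJ hbefore

/-- The greedy algorithm achieves performance `1 / (1 + w)` for delay at least `1 / 2`. -/
lemma le_performanceOn_greedy {w T : ℝ} {n : ℕ} (hw : 0 < w) (hn : w * (1 + w) = 1 + (n - 1) * w)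
    (hT : 1 / 2 ≤ T) {I : Instance} (hI : I ∈ instances n T) :
    1 / (1 + w) ≤ (greedy w).performanceOn I := by
  classical
  have hI' := instances_mono le_rfl hT hI
  have hpos : 0 < ∑ q ∈ I, q.weight := Finset.sum_pos (fun q _ => q.weight_pos) hI.1
  have hkey : ∑ q ∈ I, q.weight ≤
      (1 + w) * ∑ q ∈ I with (greedyState w I).route.Serves q, q.weight := by
    have hfirst : ∀ p ∈ I, (greedyState w I).route.Serves p →
        ∑ q ∈ I, q.weight ≤ (1 + w) * p.weight →
        ∑ q ∈ I, q.weight ≤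
          (1 + w) * ∑ q ∈ I with (greedyState w I).route.Serves q, q.weight := by
      intro p hp hs hle
      refine hle.trans (mul_le_mul_of_nonneg_left ?_ (by linarith))
      exact Finset.single_le_sum (f := fun q : Request => q.weight)
        (fun q _ => q.weight_pos.le) (Finset.mem_filter.2 ⟨hp, hs⟩)
    rcases greedyState_cases hw.le I hI.1 hI'.2.2 with
      ⟨p, hIp, hS⟩ | ⟨p, q, hIp, hne, -, hwt, hS⟩ | hfav
    · refine hfirst p (by rw [hIp]; simp) (by rw [hS]; exact Itinerary.redirect_serves _ _) ?_
      rw [hIp, Finset.sum_singleton]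
      nlinarith [p.weight_pos]
    · refine hfirst p (by rw [hIp]; simp) (by rw [hS]; exact Itinerary.redirect_serves _ _) ?_
      rw [hIp, Finset.sum_pair hne]
      linarith
    · exact hfav.total_le hw hn hI.2.1
  unfold OnlineAlgorithm.performanceOn
  rw [div_le_div_iff₀ (by linarith) hpos, one_mul, mul_comm]
  exact hkey

lemma instances_nonempty {n : ℕ} (hn : 1 ≤ n) (T : ℝ) : (instances n T).Nonempty := by
  refine ⟨{⟨0, 0, 1, by norm_num, le_rfl, one_pos⟩}, Finset.singleton_nonempty _, by simpa, ?_⟩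
  intro p hp q hq hpq
  rw [Finset.mem_singleton] at hp hq
  exact absurd (hp.trans hq.symm) hpq

lemma optimalPerformance_eq {w T : ℝ} {n : ℕ} (hw : 0 < w) (hn1 : 1 ≤ n)
    (hn : w * (1 + w) = 1 + (n - 1) * w) (hT : 1 / 2 ≤ T)
    (hle : ∀ A : OnlineAlgorithm, A.performance n T ≤ 1 / (1 + w)) :
    optimalPerformance n T = 1 / (1 + w) := by
  have : Nonempty OnlineAlgorithm := ⟨greedy w⟩
  have : Nonempty (instances n T) := (instances_nonempty hn1 T).to_subtype
  refine le_antisymm (ciSup_le hle) ?_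
  refine le_trans ?_ (le_ciSup (f := fun A : OnlineAlgorithm => A.performance n T)
    ⟨1 / (1 + w), by rintro _ ⟨A, rfl⟩; exact hle A⟩ (greedy w))
  exact le_ciInf fun I => le_performanceOn_greedy hw hn hT I.2

end OPTiWinD

theorem mainTheorem8 (T : ℝ) (hT : 1 / 2 ≤ T) (hT' : T < 1) :
    OPTiWinD.optimalPerformance 3 T = 1 / Real.goldenRatio ^ 2 ∧
    OPTiWinD.optimalPerformance 4 T = 1 - Real.sqrt 2 / 2 := by
  constructor
  · have h1 := Real.one_lt_goldenRatio
    have h2 := Real.goldenRatio_sq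
    rw [OPTiWinD.optimalPerformance_eq (w := Real.goldenRatio) (by linarith) (by norm_num)
      (by push_cast; linarith) hT
      fun A => A.performance_three_le hT hT' h1.le (by linarith), h2, add_comm]
  · have h0 := Real.sqrt_nonneg 2
    have h2 : Real.sqrt 2 ^ 2 = 2 := Real.sq_sqrt (by norm_num)
    rw [OPTiWinD.optimalPerformance_eq (w := 1 + Real.sqrt 2) (by linarith) (by norm_num)
      (by push_cast; linarith) hT
      fun A => A.performance_four_le hT hT' (by linarith) (by linarith)]
    rw [div_eq_iff (by linarith)]
    linarith
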